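/- Let $X\subset\mathbb R^d$ be compact and let $K:X\times X\to\mathbb R$ be a Mercer kernel (continuous, symmetric and positive semi-definite). Let $P$ and $\rho$ be Borel probability measures on $X$ such that the integral operator $T_Kf(x)=\int_X K(x,y)f(y)\,dP(y)$ is one-to-one on $L^2(X,P)$, and such that $\rho$ is absolutely continuous with respect to $P$ with bounded density $d\rho/dP$. Let $\lambda_1\ge\lambda_2\ge\cdots\ge 0$ be the eigenvalues of $T_K$ on $L^2(X,P)$, repeated according to multiplicity (and continued by zeros if there are only finitely many), and $\varphi_1,\varphi_2,\dots$ corresponding eigenfunctions, orthonormal in $L^2(X,P)$ (those with $\lambda_j>0$). Put $\|\varphi\|_\rho^2=\int_X|\varphi|^2\,d\rho$ and $\kappa_1=\sup_{x\in X}K(x,x)$. Let $1\le N\le n$, let $Z_1,\dots,Z_n$ be i.i.d. random points of $X$ with law $\rho$, let $B_n=\frac1n[K(Z_i,Z_j)]_{1\le i,j\le n}$, and let $A_N=\frac1n[K(Z_i,Z_j)]_{1\le i\le n,\,1\le j\le N}$ be its principal $n\times N$ submatrix, with singular values $\mu_1(A_N)\ge\cdots\ge\mu_N(A_N)\ge0$.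 Then for every $1\le m\le N$ for which $$C_m:=\sum_{i\ge m}\frac{(i-m+1)\,\lambda_i\|\varphi_i\|_\rho^2}{\lambda_m\|\varphi_m\|_\rho^2}<+\infty$$ (with the conventions $0/0=0$ and $a/0=+\infty$ for $a>0$), the two sums below are integrable and $$\mathbb E\Big[\sum_{j=m}^N\mu_j(A_N)\Big]\le C_m\,\lambda_m\|\varphi_m\|_\rho^2,\qquad \mathbb E\Big[\sum_{j=m}^N\mu_j(A_N)^2\Big]\le C_m\,\frac{\kappa_1}{m}\,\lambda_m\|\varphi_m\|_\rho^2 .$$ In particular both bounds hold up to a constant that does not depend on $n$, $N$ or the sample. -/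

import Mathlib

open MeasureTheory ProbabilityTheory
open scoped ENNReal NNReal

noncomputable section

/-- A Mercer kernel: a continuous, symmetric, positive semi-definite real-valued kernel. -/
structure IsMercerKernel {S : Type*} [TopologicalSpace S] (K : S → S → ℝ) : Prop where
  continuous : Continuous (Function.uncurry K)
  posSemidef : ∀ (n : ℕ) (x : Fin n → S), (Matrix.of fun i j => K (x i) (x j)).PosSemidef

/-- The integral operator `f ↦ (x ↦ ∫ K(x, y) f(y) dP(y))`, computed on representatives. -/
def kernelOp {S : Type*} [MeasurableSpace S] (K : S → S → ℝ) (P : Measure S)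
    (f : S → ℝ) (x : S) : ℝ :=
  ∫ y, K x y * f y ∂P

/-- The integral operator is one-to-one on `L²(P)` (functions are identified `P`-a.e.). -/
def KernelOpInjective {S : Type*} [MeasurableSpace S] (K : S → S → ℝ) (P : Measure S) : Prop :=
  ∀ f g : S → ℝ, MemLp f 2 P → MemLp g 2 P →
    kernelOp K P f =ᵐ[P] kernelOp K P g → f =ᵐ[P] g

/-- `ρ` is absolutely continuous with respect to `P`, with a bounded density `dρ/dP`. -/
def HasBoundedDensity {S : Type*} [MeasurableSpace S] (ρ P : Measure S) : Prop :=
  ρ ≪ P ∧ ∃ C : ℝ≥0, ∀ᵐ x ∂P, ρ.rnDeriv P x ≤ C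

/-- `lam 0 ≥ lam 1 ≥ ⋯ ≥ 0` is the sequence of all positive eigenvalues of the integral operator on
`L²(P)`, in decreasing order and repeated according to multiplicity, and `phi j` is an eigenfunction
for `lam j`, those with `lam j > 0` being orthonormal in `L²(P)`. If there are only finitely many
positive eigenvalues (this can happen only for a degenerate kernel or measure), the sequence is
continued by zeros. Indices start at `0`. -/
structure IsEigenSystem {S : Type*} [MeasurableSpace S] (K : S → S → ℝ) (P : Measure S)
    (lam : ℕ → ℝ) (phi : ℕ → S → ℝ) : Prop where
  antitone : Antitone lam
  nonneg : ∀ j, 0 ≤ lam j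
  memLp : ∀ j, MemLp (phi j) 2 P
  eigen : ∀ j, kernelOp K P (phi j) =ᵐ[P] fun x => lam j * phi j x
  orthonormal : ∀ i j, 0 < lam i → 0 < lam j →
    ∫ x, phi i x * phi j x ∂P = if i = j then 1 else 0
  /-- Nothing is missing: an eigenfunction with a nonzero eigenvalue that is orthogonal to all the
  listed ones vanishes. -/
  exhaustive : ∀ (c : ℝ) (f : S → ℝ), c ≠ 0 → MemLp f 2 P →
    kernelOp K P f =ᵐ[P] (fun x => c * f x) →
    (∀ j, 0 < lam j → ∫ x, f x * phi j x ∂P = 0) → f =ᵐ[P] 0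

/-- `‖f‖²_ρ = ∫ |f|² dρ`. -/
def sqNorm {S : Type*} [MeasurableSpace S] (ρ : Measure S) (f : S → ℝ) : ℝ :=
  ∫ x, |f x| ^ 2 ∂ρ

/-- `∑_{i ≥ m} (i - m + 1) λ_i ‖φ_i‖²_ρ / (λ_m ‖φ_m‖²_ρ)`, as an element of `[0, ∞]`
(the summation index is shifted by `m`). -/
def tailRatio {S : Type*} [MeasurableSpace S] (ρ : Measure S)
    (lam : ℕ → ℝ) (phi : ℕ → S → ℝ) (m : ℕ) : ℝ≥0∞ :=
  ∑' i : ℕ, ENNReal.ofReal (((i : ℝ) + 1) * lam (m + i) * sqNorm ρ (phi (m + i))) /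
    ENNReal.ofReal (lam m * sqNorm ρ (phi m))

/-- The Gram matrix `B_n = (1/n) [K(x_i, x_j)]`, of size `n × n`. -/
def gramMatrix {S : Type*} (K : S → S → ℝ) {n : ℕ} (x : Fin n → S) :
    Matrix (Fin n) (Fin n) ℝ :=
  Matrix.of fun i j => 1 / (n : ℝ) * K (x i) (x j)

/-- The principal `n × N` submatrix `A_N` of the Gram matrix `B_n`: its first `N` columns. -/
def truncGramMatrix {S : Type*} (K : S → S → ℝ) {n N : ℕ} (hN : N ≤ n) (x : Fin n → S) :
    Matrix (Fin n) (Fin N) ℝ :=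
  (gramMatrix K x).submatrix id (Fin.castLE hN)

/-- The singular values of a real matrix in decreasing order, with indices starting at `0`
(and equal to `0` from the number of columns on). -/
def singVal {n N : ℕ} (A : Matrix (Fin n) (Fin N) ℝ) (j : ℕ) : ℝ :=
  (Matrix.toEuclideanLin A).singularValues j

end

/-! Write `K x y = ⟪k x, k y⟫` with `k` continuous into a Hilbert space `H`. Then `B_n` is `1/n`
times a Gram matrix, hence positive, and deleting columns only lowers singular values; so it
suffices to bound the tail eigenvalues of `B_n`.

Let `S : H → L²(P)` be `h ↦ ⟪h, k ·⟫`, so that the integral operator is `S S*`. The vectors `e_j =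
λ_j^(-1/2) S* φ_j` are orthonormal, and `⟪e_j, k x⟫ = √λ_j φ_j(x)` almost everywhere. Remove from
each `k (Z_i)` its components along `e_0, …, e_(m-1)`. The quadratic form of the Gram matrix is
unchanged on a subspace of codimension at most `m`, so Weyl's inequality bounds the tail sum by the
trace of the new Gram matrix (`sum_singularValues_gram_le`). That trace averages a residual over the
sample, and its expectation is the integral of the residual against `ρ`. By Mercer's theorem on the
support of `P`, this integral is `∑_{i ≥ m} λ_i ‖φ_i‖²_ρ` (`ofReal_integral_residual`), which is at
most `C_m λ_m ‖φ_m‖²_ρ` because the weights in `C_m` are at least `1`.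

For the squares, one factor is bounded by `κ₁ / (m + 1)`: the `m + 1` largest eigenvalues of `B_n`
sum to at most its trace, which is at most `κ₁`. Indices start at `0`, so this is the stated `κ₁ /
m`. -/

/-! ### Min-max principles for eigenvalues and singular values -/

section MinMax

open Module

variable {E F : Type*} [NormedAddCommGroup E] [InnerProductSpace ℝ E] [FiniteDimensional ℝ E]
  [NormedAddCommGroup F] [InnerProductSpace ℝ F] [FiniteDimensional ℝ F]

theorem exists_mem_inf_ne_zero (V W : Submodule ℝ E)
    (h : finrank ℝ E < finrank ℝ V + finrank ℝ W) : ∃ x ∈ V ⊓ W, x ≠ 0 := by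
  apply Submodule.exists_mem_ne_zero_of_ne_bot
  intro hbot
  have := Submodule.finrank_add_finrank_le_of_disjoint (disjoint_iff.mpr hbot)
  omega

omit [FiniteDimensional ℝ E] in
/-- The span of a part of an orthonormal basis. -/
theorem exists_submodule_of_orthonormalBasis {n : ℕ} (b : OrthonormalBasis (Fin n) ℝ E)
    (s : Finset (Fin n)) : ∃ V : Submodule ℝ E, finrank ℝ V = s.card ∧
      ∀ x ∈ V, ∀ i ∉ s, inner ℝ (b i) x = 0 := by
  refine ⟨Submodule.span ℝ (Set.range fun i : s => b i), ?_, ?_⟩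
  · rw [finrank_span_eq_card]
    · simp
    · exact b.orthonormal.linearIndependent.comp _ Subtype.val_injective
  · intro x hx i hi
    induction hx using Submodule.span_induction with
    | mem y hy =>
      obtain ⟨j, rfl⟩ := hy
      exact b.orthonormal.2 (by rintro rfl; exact hi j.2)
    | zero => simp
    | add y z _ _ hy hz => simp [inner_add_right, hy, hz]
    | smul c y _ hy => simp [inner_smul_right, hy]

namespace LinearMap

theorem IsSymmetric.inner_eigenvectorBasis_apply {T : E →ₗ[ℝ] E} (hT : T.IsSymmetric) {n : ℕ}
    (hn : finrank ℝ E = n) (x : E) (i : Fin n) :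
    inner ℝ (hT.eigenvectorBasis hn i) (T x) =
      hT.eigenvalues hn i * inner ℝ (hT.eigenvectorBasis hn i) x := by
  rw [← hT, hT.apply_eigenvectorBasis, inner_smul_left]
  simp

theorem IsSymmetric.inner_apply_self_eq_sum {T : E →ₗ[ℝ] E} (hT : T.IsSymmetric) {n : ℕ}
    (hn : finrank ℝ E = n) (x : E) :
    inner ℝ x (T x) =
      ∑ i, hT.eigenvalues hn i * inner ℝ (hT.eigenvectorBasis hn i) x ^ 2 := by
  rw [← (hT.eigenvectorBasis hn).sum_inner_mul_inner]
  refine Finset.sum_congr rfl fun i _ => ?_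
  rw [hT.inner_eigenvectorBasis_apply, real_inner_comm x]
  ring

/-- One half of Courant–Fischer: the span of the top `j + 1` eigenvectors works. The next lemma is
the other half, with the eigenvectors from `j` on; a dimension count makes two such subspaces
intersect. -/
theorem IsSymmetric.exists_submodule_le_inner {T : E →ₗ[ℝ] E} (hT : T.IsSymmetric) {n : ℕ}
    (hn : finrank ℝ E = n) (j : Fin n) : ∃ V : Submodule ℝ E, finrank ℝ V = j + 1 ∧
      ∀ x ∈ V, hT.eigenvalues hn j * ‖x‖ ^ 2 ≤ inner ℝ x (T x) := by
  obtain ⟨V, hV, h⟩ := exists_submodule_of_orthonormalBasis (hT.eigenvectorBasis hn) (Finset.Iic j)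
  refine ⟨V, by simpa using hV, fun x hx => ?_⟩
  rw [hT.inner_apply_self_eq_sum hn, ← (hT.eigenvectorBasis hn).sum_sq_inner_right x,
    Finset.mul_sum]
  refine Finset.sum_le_sum fun i _ => ?_
  by_cases hi : i ≤ j
  · exact mul_le_mul_of_nonneg_right (hT.eigenvalues_antitone hn hi) (sq_nonneg _)
  · simp [h x hx i (by simpa using hi)]

theorem IsSymmetric.exists_submodule_inner_le {T : E →ₗ[ℝ] E} (hT : T.IsSymmetric) {n : ℕ}
    (hn : finrank ℝ E = n) (j : Fin n) : ∃ W : Submodule ℝ E, finrank ℝ W + j = finrank ℝ E ∧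
      ∀ x ∈ W, inner ℝ x (T x) ≤ hT.eigenvalues hn j * ‖x‖ ^ 2 := by
  obtain ⟨W, hW, h⟩ := exists_submodule_of_orthonormalBasis (hT.eigenvectorBasis hn) (Finset.Ici j)
  refine ⟨W, by rw [hW, Fin.card_Ici]; omega, fun x hx => ?_⟩
  rw [hT.inner_apply_self_eq_sum hn, ← (hT.eigenvectorBasis hn).sum_sq_inner_right x,
    Finset.mul_sum]
  refine Finset.sum_le_sum fun i _ => ?_
  by_cases hi : j ≤ i
  · exact mul_le_mul_of_nonneg_right (hT.eigenvalues_antitone hn hi) (sq_nonneg _)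
  · simp [h x hx i (by simpa using hi)]

theorem inner_adjoint_comp_self (A : E →ₗ[ℝ] F) (x : E) :
    inner ℝ x ((A.adjoint ∘ₗ A) x) = ‖A x‖ ^ 2 := by
  rw [LinearMap.comp_apply, LinearMap.adjoint_inner_right, real_inner_self_eq_norm_sq]

theorem exists_submodule_singularValues_le (A : E →ₗ[ℝ] F) {j : ℕ} (hj : j < finrank ℝ E) :
    ∃ V : Submodule ℝ E, finrank ℝ V = j + 1 ∧ ∀ x ∈ V, A.singularValues j * ‖x‖ ≤ ‖A x‖ := by
  obtain ⟨V, hV, h⟩ := A.isSymmetric_adjoint_comp_self.exists_submodule_le_inner rfl ⟨j, hj⟩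
  refine ⟨V, hV, fun x hx => ?_⟩
  have := h x hx
  rw [inner_adjoint_comp_self, ← A.sq_singularValues_of_lt, ← mul_pow] at this
  exact le_of_sq_le_sq this (norm_nonneg _)

theorem exists_submodule_le_singularValues (A : E →ₗ[ℝ] F) (j : ℕ) :
    ∃ W : Submodule ℝ E, finrank ℝ E ≤ finrank ℝ W + j ∧
      ∀ x ∈ W, ‖A x‖ ≤ A.singularValues j * ‖x‖ := by
  rcases lt_or_ge j (finrank ℝ E) with hj | hj
  · obtain ⟨W, hW, h⟩ := A.isSymmetric_adjoint_comp_self.exists_submodule_inner_le rfl ⟨j, hj⟩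
    refine ⟨W, hW.ge, fun x hx => ?_⟩
    have := h x hx
    rw [inner_adjoint_comp_self, ← A.sq_singularValues_of_lt, ← mul_pow] at this
    exact le_of_sq_le_sq this (mul_nonneg (A.singularValues_nonneg _) (norm_nonneg _))
  · exact ⟨⊥, by omega, fun x hx => by simp [(Submodule.mem_bot ℝ).mp hx]⟩

theorem singularValues_comp_linearIsometry_le {E' : Type*} [NormedAddCommGroup E']
    [InnerProductSpace ℝ E'] [FiniteDimensional ℝ E'] (A : E →ₗ[ℝ] F) (J : E' →ₗᵢ[ℝ] E) (j : ℕ) :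
    (A ∘ₗ J.toLinearMap).singularValues j ≤ A.singularValues j := by
  rcases lt_or_ge j (finrank ℝ E') with hj | hj
  · obtain ⟨V, hV, h⟩ := (A ∘ₗ J.toLinearMap).exists_submodule_singularValues_le hj
    obtain ⟨W, hW, h'⟩ := A.exists_submodule_le_singularValues j
    have hVJ : finrank ℝ (V.map J.toLinearMap) = finrank ℝ V :=
      (LinearEquiv.finrank_eq (Submodule.equivMapOfInjective _ J.injective V)).symm
    obtain ⟨y, ⟨hyV, hyW⟩, hy⟩ := exists_mem_inf_ne_zero (V.map J.toLinearMap) W (by omega)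
    obtain ⟨x, hx, rfl⟩ := hyV
    have h1 := h x hx
    have h2 := h' _ hyW
    simp only [LinearMap.comp_apply, LinearIsometry.coe_toLinearMap,
      LinearIsometry.norm_map] at h1 h2
    have : 0 < ‖x‖ := by
      rw [norm_pos_iff]; rintro rfl; simp at hy
    exact le_of_mul_le_mul_right (h1.trans h2) this
  · rw [singularValues_of_finrank_le _ hj]
    exact A.singularValues_nonneg j

/-- This perturbation bound serves to prove that singular values are continuous in the matrix, hence
measurable in the sample. -/
theorem singularValues_le_add (A A' : E →ₗ[ℝ] F) {c : ℝ} (hc : 0 ≤ c)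
    (h : ∀ x, ‖A x - A' x‖ ≤ c * ‖x‖) (j : ℕ) :
    A.singularValues j ≤ A'.singularValues j + c := by
  rcases lt_or_ge j (finrank ℝ E) with hj | hj
  · obtain ⟨V, hV, h1⟩ := A.exists_submodule_singularValues_le hj
    obtain ⟨W, hW, h2⟩ := A'.exists_submodule_le_singularValues j
    obtain ⟨x, ⟨hxV, hxW⟩, hx⟩ := exists_mem_inf_ne_zero V W (by omega)
    have h3 := h1 x hxV
    have h4 := h2 x hxW
    have h5 := h x
    have h6 := norm_le_norm_add_norm_sub' (A x) (A' x)
    refine le_of_mul_le_mul_right ?_ (norm_pos_iff.mpr hx)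
    linarith
  · rw [singularValues_of_finrank_le _ hj]
    exact add_nonneg (A'.singularValues_nonneg j) hc

/-- Singular values come from an eigenbasis of `T* T`, not of `T`, so the two are compared by
intersecting min-max subspaces. Positivity allows eigenvalue inequalities to be squared. -/
theorem IsPositive.eigenvalues_eq_singularValues {T : E →ₗ[ℝ] E} (hT : T.IsPositive) {n : ℕ}
    (hn : finrank ℝ E = n) (j : Fin n) :
    hT.isSymmetric.eigenvalues hn j = T.singularValues j := by
  apply le_antisymm
  · obtain ⟨V, hV, h1⟩ := hT.isSymmetric.exists_submodule_le_inner hn j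
    obtain ⟨W, hW, h2⟩ := T.exists_submodule_le_singularValues j
    obtain ⟨x, ⟨hxV, hxW⟩, hx⟩ := exists_mem_inf_ne_zero V W (by omega)
    have h3 := h1 x hxV
    have h4 := h2 x hxW
    have h5 := real_inner_le_norm x (T x)
    have h6 := mul_le_mul_of_nonneg_left h4 (norm_nonneg x)
    have : 0 < ‖x‖ ^ 2 := by positivity
    refine le_of_mul_le_mul_right ?_ this
    linarith
  · obtain ⟨V, hV, h1⟩ := T.exists_submodule_singularValues_le (j := j) (by omega)
    obtain ⟨W, hW, h⟩ := exists_submodule_of_orthonormalBasis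
      (hT.isSymmetric.eigenvectorBasis hn) (Finset.Ici j)
    rw [Fin.card_Ici] at hW
    obtain ⟨x, ⟨hxV, hxW⟩, hx⟩ := exists_mem_inf_ne_zero V W (by omega)
    have h3 := h1 x hxV
    have h0 := hT.nonneg_eigenvalues hn
    have h4 : ‖T x‖ ^ 2 ≤ (hT.isSymmetric.eigenvalues hn j * ‖x‖) ^ 2 := by
      rw [mul_pow, ← (hT.isSymmetric.eigenvectorBasis hn).sum_sq_inner_right x,
        ← (hT.isSymmetric.eigenvectorBasis hn).sum_sq_inner_right (T x), Finset.mul_sum]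
      refine Finset.sum_le_sum fun i _ => ?_
      rw [hT.isSymmetric.inner_eigenvectorBasis_apply, mul_pow]
      by_cases hi : j ≤ i
      · refine mul_le_mul_of_nonneg_right ?_ (sq_nonneg _)
        exact pow_le_pow_left₀ (h0 i) (hT.isSymmetric.eigenvalues_antitone hn hi) 2
      · simp [h x hxW i (by simpa using hi)]
    have h5 := le_of_sq_le_sq h4 (mul_nonneg (h0 j) (norm_nonneg _))
    exact le_of_mul_le_mul_right (h3.trans h5) (norm_pos_iff.mpr hx)

theorem IsPositive.sum_singularValues {T : E →ₗ[ℝ] E} (hT : T.IsPositive) {n : ℕ}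
    (hn : finrank ℝ E = n) : ∑ j ∈ Finset.range n, T.singularValues j = LinearMap.trace ℝ E T := by
  rw [hT.isSymmetric.trace_eq_sum_eigenvalues hn, Finset.sum_range]
  simp [hT.eigenvalues_eq_singularValues]

/-- Weyl's inequality when `T` and `R` agree on a subspace of codimension at most `m`. -/
theorem IsPositive.singularValues_add_le {T R : E →ₗ[ℝ] E} (hT : T.IsPositive) (hR : R.IsPositive)
    {m : ℕ} (U : Submodule ℝ E) (hU : finrank ℝ E ≤ finrank ℝ U + m)
    (h : ∀ x ∈ U, inner ℝ x (T x) ≤ inner ℝ x (R x)) (j : ℕ) :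
    T.singularValues (m + j) ≤ R.singularValues j := by
  rcases lt_or_ge (m + j) (finrank ℝ E) with hj | hj
  · obtain ⟨V, hV, h1⟩ := hT.isSymmetric.exists_submodule_le_inner rfl ⟨m + j, hj⟩
    obtain ⟨W, hW, h2⟩ := hR.isSymmetric.exists_submodule_inner_le rfl ⟨j, by omega⟩
    rw [hT.eigenvalues_eq_singularValues] at h1
    rw [hR.eigenvalues_eq_singularValues] at h2
    simp only at hV hW h1 h2
    -- `V ⊓ U` has dimension at least `(m + j + 1) - m = j + 1`, while `W` has codimension `j`.
    have h3 := Submodule.finrank_sup_add_finrank_inf_eq V U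
    have h4 := Submodule.finrank_le (V ⊔ U)
    obtain ⟨x, ⟨⟨hxV, hxU⟩, hxW⟩, hx⟩ := exists_mem_inf_ne_zero (V ⊓ U) W (by omega)
    have : 0 < ‖x‖ ^ 2 := by positivity
    exact le_of_mul_le_mul_right ((h1 x hxV).trans ((h x hxU).trans (h2 x hxW))) this
  · rw [singularValues_of_finrank_le _ hj]
    exact R.singularValues_nonneg j

theorem IsPositive.sum_singularValues_Ico_le_trace {T R : E →ₗ[ℝ] E} (hT : T.IsPositive)
    (hR : R.IsPositive) {m n : ℕ} (hn : finrank ℝ E = n) (U : Submodule ℝ E)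
    (hU : n ≤ finrank ℝ U + m) (h : ∀ x ∈ U, inner ℝ x (T x) ≤ inner ℝ x (R x)) :
    ∑ j ∈ Finset.Ico m n, T.singularValues j ≤ LinearMap.trace ℝ E R := by
  rw [← hR.sum_singularValues hn, Finset.sum_Ico_eq_sum_range]
  calc _ ≤ ∑ j ∈ Finset.range (n - m), R.singularValues j :=
        Finset.sum_le_sum fun j _ => hT.singularValues_add_le hR U (by omega) h j
    _ ≤ _ := Finset.sum_le_sum_of_subset_of_nonneg
        (Finset.range_subset_range.mpr (Nat.sub_le n m)) fun j _ _ => R.singularValues_nonneg j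

theorem IsPositive.add_one_mul_singularValues_le_trace {T : E →ₗ[ℝ] E} (hT : T.IsPositive)
    {m n : ℕ} (hn : finrank ℝ E = n) (hm : m < n) :
    ((m : ℝ) + 1) * T.singularValues m ≤ LinearMap.trace ℝ E T := by
  rw [← hT.sum_singularValues hn]
  calc ((m : ℝ) + 1) * T.singularValues m
      = ∑ j ∈ Finset.range (m + 1), T.singularValues m := by simp
    _ ≤ ∑ j ∈ Finset.range (m + 1), T.singularValues j :=
        Finset.sum_le_sum fun j hj => T.singularValues_antitone (by
          have := Finset.mem_range.mp hj; omega)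
    _ ≤ _ := Finset.sum_le_sum_of_subset_of_nonneg
        (Finset.range_subset_range.mpr hm) fun j _ _ => T.singularValues_nonneg j

end LinearMap

end MinMax

/-! ### Mercer's theorem through a feature map -/

section Mercer

open InnerProductSpace Filter Topology

/-- Parseval for a single vector: the hypothesis says that `x` lies in the closed span of `v`.
Completeness of `v` in all of `H` would be too much to ask, since the features only see the support
of `P`. -/
theorem hasSum_inner_sq_of_orthonormal {H : Type*} [NormedAddCommGroup H] [InnerProductSpace ℝ H]
    [CompleteSpace H] {ι : Type*} {v : ι → H} (hv : Orthonormal ℝ v) {x : H}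
    (hx : ∀ h : H, (∀ i, inner ℝ (v i) h = 0) → inner ℝ h x = 0) :
    HasSum (fun i => inner ℝ (v i) x ^ 2) (‖x‖ ^ 2) := by
  let U := (Submodule.span ℝ (Set.range v)).topologicalClosure
  have hvU : ∀ i, v i ∈ U := fun i =>
    Submodule.le_topologicalClosure _ (Submodule.subset_span ⟨i, rfl⟩)
  have : CompleteSpace U := (Submodule.isClosed_topologicalClosure _).completeSpace_coe
  have key : ∀ h : H, (∀ i, inner ℝ (v i) h = 0) → h ∈ Uᗮ := by
    intro h hh
    rw [Submodule.orthogonal_closure, Submodule.mem_orthogonal]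
    intro u hu
    induction hu using Submodule.span_induction with
    | mem y hy => obtain ⟨i, rfl⟩ := hy; exact hh i
    | zero => simp
    | add y z _ _ hy hz => simp [inner_add_left, hy, hz]
    | smul c y _ hy => simp [inner_smul_left, hy]
  have hxU : x ∈ U := by
    rw [← Submodule.orthogonal_orthogonal U, Submodule.mem_orthogonal]
    exact fun h hh => hx h fun i => Submodule.inner_right_of_mem_orthogonal (hvU i) hh
  let w : ι → U := fun i => ⟨v i, hvU i⟩
  have hw : Orthonormal ℝ w := by
    constructor
    · exact fun i => hv.1 i
    · exact fun i j hij => hv.2 hij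
  have hbot : (Submodule.span ℝ (Set.range w))ᗮ = ⊥ := by
    rw [Submodule.eq_bot_iff]
    intro u hu
    have h0 : ∀ i, inner ℝ (w i) u = 0 := fun i =>
      Submodule.inner_right_of_mem_orthogonal (Submodule.subset_span (Set.mem_range_self i)) hu
    have h1 : (u : H) ∈ Uᗮ := key _ h0
    have h2 : inner ℝ (u : H) u = 0 := Submodule.inner_right_of_mem_orthogonal u.2 h1
    exact Subtype.ext (inner_self_eq_zero.mp h2)
  have h := (HilbertBasis.mkOfOrthogonalEqBot hw hbot).hasSum_inner_mul_inner ⟨x, hxU⟩ ⟨x, hxU⟩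
  rw [HilbertBasis.coe_mkOfOrthogonalEqBot, real_inner_self_eq_norm_sq] at h
  simpa only [Submodule.coe_inner, Submodule.coe_norm, w, real_inner_comm, ← sq] using h

variable {S : Type*} [TopologicalSpace S] [CompactSpace S]
  {H : Type*} [NormedAddCommGroup H] [InnerProductSpace ℝ H]

/-- The operator `h ↦ (s ↦ ⟪h, k s⟫)` from a Hilbert space to bounded continuous functions. -/
noncomputable def featureEval (k : C(S, H)) : H →L[ℝ] BoundedContinuousFunction S ℝ :=
  LinearMap.mkContinuous
    { toFun := fun h => BoundedContinuousFunction.mkOfCompact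
        ⟨fun s => inner ℝ h (k s), by fun_prop⟩
      map_add' := fun a b => by ext s; simp [inner_add_left]
      map_smul' := fun c a => by ext s; simp [inner_smul_left] } ‖k‖ (by
    intro h
    refine (BoundedContinuousFunction.norm_le (by positivity)).mpr fun s => ?_
    refine (norm_inner_le_norm _ _).trans ?_
    rw [mul_comm]
    exact mul_le_mul_of_nonneg_right (k.norm_coe_le_norm s) (norm_nonneg _))

@[simp]
theorem featureEval_apply (k : C(S, H)) (h : H) (s : S) :
    featureEval k h s = inner ℝ h (k s) := rfl

/-- Arzelà–Ascoli: on the unit ball, `|⟪h, k s - k t⟫| ≤ ‖k s - k t‖` gives equicontinuity. -/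
theorem isCompactOperator_featureEval (k : C(S, H)) : IsCompactOperator (featureEval k) := by
  rw [isCompactOperator_iff_exists_mem_nhds_isCompact_closure_image]
  refine ⟨Metric.ball 0 1, Metric.ball_mem_nhds _ one_pos, ?_⟩
  refine BoundedContinuousFunction.arzela_ascoli (Metric.closedBall 0 ‖k‖)
    (isCompact_closedBall _ _) _ ?_ ?_
  · rintro _ s ⟨h, hh, rfl⟩
    rw [mem_closedBall_zero_iff, featureEval_apply]
    refine (norm_inner_le_norm _ _).trans ?_
    have h1 := k.norm_coe_le_norm s
    have h2 := mem_ball_zero_iff.mp hh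
    nlinarith [norm_nonneg h, norm_nonneg (k s)]
  · intro s
    rw [Metric.equicontinuousAt_iff_right]
    intro ε hε
    filter_upwards [(Metric.tendsto_nhds.mp k.continuous.continuousAt) ε hε] with t ht
    rintro ⟨_, h, hh, rfl⟩
    simp only [featureEval_apply, Real.dist_eq, ← inner_sub_right]
    refine (abs_real_inner_le_norm _ _).trans_lt ?_
    rw [dist_comm, dist_eq_norm] at ht
    have h2 := mem_ball_zero_iff.mp hh
    nlinarith [norm_nonneg h, norm_nonneg (k s - k t)]

variable [MeasurableSpace S] [BorelSpace S]

/-- The operator `h ↦ (s ↦ ⟪h, k s⟫)` from a Hilbert space to `L²(P)`. -/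
noncomputable def featureEvalL2 (k : C(S, H)) (P : Measure S) [IsFiniteMeasure P] :
    H →L[ℝ] Lp ℝ 2 P :=
  (BoundedContinuousFunction.toLp 2 P ℝ).comp (featureEval k)

theorem coeFn_featureEvalL2 (k : C(S, H)) (P : Measure S) [IsFiniteMeasure P] (h : H) :
    featureEvalL2 k P h =ᵐ[P] fun s => inner ℝ h (k s) :=
  BoundedContinuousFunction.coeFn_toLp 2 P ℝ _

variable [CompleteSpace H]

/-- The integral operator with kernel `⟪k x, k y⟫` on `L²(P)`. -/
noncomputable def kernelOpL2 (k : C(S, H)) (P : Measure S) [IsFiniteMeasure P] :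
    Lp ℝ 2 P →L[ℝ] Lp ℝ 2 P :=
  (featureEvalL2 k P).comp (featureEvalL2 k P).adjoint

theorem isCompactOperator_kernelOpL2 (k : C(S, H)) (P : Measure S) [IsFiniteMeasure P] :
    IsCompactOperator (kernelOpL2 k P) :=
  ((isCompactOperator_featureEval k).clm_comp
    (BoundedContinuousFunction.toLp 2 P ℝ)).comp_clm (featureEvalL2 k P).adjoint

theorem isSymmetric_kernelOpL2 (k : C(S, H)) (P : Measure S) [IsFiniteMeasure P] :
    (kernelOpL2 k P : Lp ℝ 2 P →ₗ[ℝ] Lp ℝ 2 P).IsSymmetric := by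
  intro f g
  simp only [kernelOpL2, ContinuousLinearMap.coe_coe, ContinuousLinearMap.comp_apply]
  rw [← ContinuousLinearMap.adjoint_inner_right, ContinuousLinearMap.adjoint_inner_left]

variable {K : S → S → ℝ} {k : C(S, H)} {P : Measure S} [IsFiniteMeasure P]

/-- The adjoint sends `f` to the weak integral of `f(y) k(y)`, so this identity holds at every point
and not only almost everywhere. -/
theorem inner_adjoint_featureEvalL2 (hk : ∀ x y, K x y = inner ℝ (k x) (k y)) {f : S → ℝ}
    (hf : MemLp f 2 P) (x : S) :
    inner ℝ ((featureEvalL2 k P).adjoint hf.toLp) (k x) = kernelOp K P f x := by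
  rw [ContinuousLinearMap.adjoint_inner_left, L2.inner_def]
  refine integral_congr_ae ?_
  filter_upwards [hf.coeFn_toLp, coeFn_featureEvalL2 k P (k x)] with y h1 h2
  rw [h1, h2, hk]
  simp

theorem coeFn_kernelOpL2 (hk : ∀ x y, K x y = inner ℝ (k x) (k y)) {f : S → ℝ}
    (hf : MemLp f 2 P) : kernelOpL2 k P hf.toLp =ᵐ[P] kernelOp K P f := by
  filter_upwards [coeFn_featureEvalL2 k P ((featureEvalL2 k P).adjoint hf.toLp)] with x hx
  rw [kernelOpL2, ContinuousLinearMap.comp_apply, hx, inner_adjoint_featureEvalL2 hk]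

theorem coeFn_kernelOpL2' (hk : ∀ x y, K x y = inner ℝ (k x) (k y)) (f : Lp ℝ 2 P) :
    kernelOpL2 k P f =ᵐ[P] kernelOp K P f := by
  have := coeFn_kernelOpL2 hk (Lp.memLp f)
  rwa [Lp.toLp_coeFn] at this

theorem continuous_kernelOp (hk : ∀ x y, K x y = inner ℝ (k x) (k y)) {f : S → ℝ}
    (hf : MemLp f 2 P) : Continuous (kernelOp K P f) := by
  simp_rw [← funext (inner_adjoint_featureEvalL2 hk hf)]
  fun_prop

variable {lam : ℕ → ℝ} {phi : ℕ → S → ℝ}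

theorem IsEigenSystem.kernelOpL2_toLp (hphi : IsEigenSystem K P lam phi)
    (hk : ∀ x y, K x y = inner ℝ (k x) (k y)) (j : ℕ) :
    kernelOpL2 k P (hphi.memLp j).toLp = lam j • (hphi.memLp j).toLp := by
  refine Lp.ext ?_
  filter_upwards [coeFn_kernelOpL2 hk (hphi.memLp j), hphi.eigen j, (hphi.memLp j).coeFn_toLp,
    Lp.coeFn_smul (lam j) (hphi.memLp j).toLp] with x h1 h2 h3 h4
  rw [h1, h2, h4, Pi.smul_apply, h3, smul_eq_mul]

omit [TopologicalSpace S] [CompactSpace S] [BorelSpace S] [IsFiniteMeasure P] in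
theorem IsEigenSystem.inner_toLp (hphi : IsEigenSystem K P lam phi) {i j : ℕ} (hi : 0 < lam i)
    (hj : 0 < lam j) :
    inner ℝ (hphi.memLp i).toLp (hphi.memLp j).toLp = if i = j then (1 : ℝ) else 0 := by
  rw [← hphi.orthonormal i j hi hj, L2.inner_def]
  refine integral_congr_ae ?_
  filter_upwards [(hphi.memLp i).coeFn_toLp, (hphi.memLp j).coeFn_toLp] with x h1 h2
  rw [h1, h2]
  simp [mul_comm]

/-- If the integral operator is injective, its eigenfunctions form a complete system. -/
theorem IsEigenSystem.eq_zero_of_orthogonal (hphi : IsEigenSystem K P lam phi)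
    (hk : ∀ x y, K x y = inner ℝ (k x) (k y)) (hinj : KernelOpInjective K P) {f : Lp ℝ 2 P}
    (hf : ∀ j, 0 < lam j → inner ℝ (hphi.memLp j).toLp f = 0) : f = 0 := by
  let T := kernelOpL2 k P
  let V := Submodule.span ℝ {g : Lp ℝ 2 P | ∃ j, 0 < lam j ∧ g = (hphi.memLp j).toLp}
  let M := V.topologicalClosure
  have hM : CompleteSpace M := (Submodule.isClosed_topologicalClosure _).completeSpace_coe
  have hmem : ∀ j, 0 < lam j → (hphi.memLp j).toLp ∈ M := fun j hj =>
    Submodule.le_topologicalClosure _ (Submodule.subset_span ⟨j, hj, rfl⟩)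
  have horth : ∀ g : Lp ℝ 2 P, (∀ j, 0 < lam j → inner ℝ (hphi.memLp j).toLp g = 0) → g ∈ Mᗮ := by
    intro g hg
    rw [Submodule.orthogonal_closure, Submodule.mem_orthogonal]
    intro u hu
    induction hu using Submodule.span_induction with
    | mem y hy => obtain ⟨j, hj, rfl⟩ := hy; exact hg j hj
    | zero => simp
    | add y z _ _ hy hz => simp [inner_add_left, hy, hz]
    | smul c y _ hy => simp [inner_smul_left, hy]
  have hsymm : ∀ g h, inner ℝ (T g) h = inner ℝ g (T h) := isSymmetric_kernelOpL2 k P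
  have hTV : V ≤ M.comap T.toLinearMap := by
    refine Submodule.span_le.mpr ?_
    rintro _ ⟨j, hj, rfl⟩
    change T _ ∈ M
    rw [hphi.kernelOpL2_toLp hk]
    exact M.smul_mem _ (hmem j hj)
  have hTM : ∀ g ∈ M, T g ∈ M := by
    have h1 : M ≤ M.comap T.toLinearMap :=
      Submodule.topologicalClosure_minimal _ hTV
        ((Submodule.isClosed_topologicalClosure V).preimage T.continuous)
    exact fun g hg => h1 hg
  have hTM' : ∀ g ∈ Mᗮ, T g ∈ Mᗮ := by
    intro g hg
    rw [Submodule.mem_orthogonal]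
    intro u hu
    rw [← hsymm]
    exact Submodule.inner_right_of_mem_orthogonal (hTM u hu) hg
  have heig : ∀ c : ℝ, Module.End.eigenspace T.toLinearMap c ≤ M := by
    intro c v hv
    have hv : T v = c • v := Module.End.mem_eigenspace_iff.mp hv
    -- Injectivity excludes the eigenvalue `0`. For `c ≠ 0`, the component of `v` in `Mᗮ` is again
    -- an eigenvector, and `exhaustive` makes it vanish.
    rcases eq_or_ne c 0 with rfl | hc
    · have h0 : v = 0 := by
        refine Lp.ext ?_
        have h1 : kernelOp K P v =ᵐ[P] kernelOp K P (0 : Lp ℝ 2 P) :=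
          (coeFn_kernelOpL2' hk v).symm.trans
            ((Filter.EventuallyEq.of_eq (by
              change (T v : S → ℝ) = T 0
              rw [hv]; simp)).trans (coeFn_kernelOpL2' hk 0))
        exact hinj _ _ (Lp.memLp v) (Lp.memLp 0) h1
      rw [h0]
      exact M.zero_mem
    · obtain ⟨p, hp, w, hw, rfl⟩ := M.exists_add_mem_mem_orthogonal v
      have h1 : T w - c • w = -(T p - c • p) := by
        rw [map_add, smul_add] at hv
        rw [← sub_eq_zero, ← sub_eq_zero.mpr hv]
        abel
      have h2 : T w - c • w ∈ Mᗮ := Mᗮ.sub_mem (hTM' w hw) (Mᗮ.smul_mem c hw)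
      have h3 : T w - c • w ∈ M := by
        rw [h1]
        exact M.neg_mem (M.sub_mem (hTM p hp) (M.smul_mem c hp))
      have h4 : T w = c • w := sub_eq_zero.mp
        (inner_self_eq_zero.mp (Submodule.inner_right_of_mem_orthogonal h3 h2))
      have h5 : kernelOp K P w =ᵐ[P] fun x => c * w x := by
        filter_upwards [coeFn_kernelOpL2' hk w, Lp.coeFn_smul c w] with x hx1 hx2
        rw [← hx1]
        change T w x = _
        rw [h4, hx2]
        simp
      have h6 : ∀ j, 0 < lam j → ∫ x, w x * phi j x ∂P = 0 := by
        intro j hj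
        rw [← Submodule.inner_right_of_mem_orthogonal (hmem j hj) hw, L2.inner_def]
        refine integral_congr_ae ?_
        filter_upwards [(hphi.memLp j).coeFn_toLp] with x hx
        rw [hx]
        simp
      have h7 : w = 0 := Lp.ext ((hphi.exhaustive c w hc (Lp.memLp w) h5 h6).trans
        (Lp.coeFn_zero ℝ 2 P).symm)
      rw [h7, add_zero]
      exact hp
  -- Spectral theorem for compact symmetric operators: the eigenspaces, all inside `M`, have trivial
  -- orthogonal complement.
  have hbot := T.orthogonalComplement_iSup_eigenspaces_eq_bot
    (isCompactOperator_kernelOpL2 k P) (isSymmetric_kernelOpL2 k P)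
  have : f ∈ (⨆ c, Module.End.eigenspace T.toLinearMap c)ᗮ :=
    Submodule.orthogonal_le (iSup_le heig) (horth f hf)
  rw [hbot] at this
  exact (Submodule.mem_bot ℝ).mp this

/-- The normalised images of the eigenfunctions in the feature space. -/
noncomputable def IsEigenSystem.feature (hphi : IsEigenSystem K P lam phi) (k : C(S, H)) (j : ℕ) :
    H :=
  (√(lam j))⁻¹ • (featureEvalL2 k P).adjoint (hphi.memLp j).toLp

theorem IsEigenSystem.inner_feature_apply (hphi : IsEigenSystem K P lam phi)
    (hk : ∀ x y, K x y = inner ℝ (k x) (k y)) (j : ℕ) (x : S) :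
    inner ℝ (hphi.feature k j) (k x) = (√(lam j))⁻¹ * kernelOp K P (phi j) x := by
  rw [IsEigenSystem.feature, inner_smul_left, inner_adjoint_featureEvalL2 hk]
  simp

/-- Since `0⁻¹ = 0`, indices with `lam j = 0`, whose `phi j` need not be orthonormal, drop out of
every sum. -/
theorem IsEigenSystem.feature_eq_zero (hphi : IsEigenSystem K P lam phi) {j : ℕ}
    (hj : ¬ 0 < lam j) : hphi.feature k j = 0 := by
  have : lam j = 0 := le_antisymm (not_lt.mp hj) (hphi.nonneg j)
  simp [IsEigenSystem.feature, this]

theorem IsEigenSystem.inner_feature_feature (hphi : IsEigenSystem K P lam phi)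
    (hk : ∀ x y, K x y = inner ℝ (k x) (k y)) {i j : ℕ} (hi : 0 < lam i) (hj : 0 < lam j) :
    inner ℝ (hphi.feature k i) (hphi.feature k j) = if i = j then (1 : ℝ) else 0 := by
  have h : inner ℝ (hphi.memLp i).toLp (featureEvalL2 k P ((featureEvalL2 k P).adjoint
      (hphi.memLp j).toLp)) = lam j * if i = j then (1 : ℝ) else 0 := by
    rw [← hphi.inner_toLp hi hj, ← inner_smul_right (𝕜 := ℝ), ← hphi.kernelOpL2_toLp hk]
    rfl
  rw [IsEigenSystem.feature, IsEigenSystem.feature, inner_smul_left, inner_smul_right,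
    ContinuousLinearMap.adjoint_inner_left, h]
  split_ifs with hij
  · subst hij
    have := Real.sq_sqrt hi.le
    have : 0 < √(lam i) := Real.sqrt_pos.mpr hi
    simp only [conj_trivial]
    field_simp
    linarith
  · simp

theorem IsEigenSystem.orthonormal_feature (hphi : IsEigenSystem K P lam phi)
    (hk : ∀ x y, K x y = inner ℝ (k x) (k y)) :
    Orthonormal ℝ fun j : {j // 0 < lam j} => hphi.feature k j := by
  rw [orthonormal_iff_ite]
  intro i j
  simp only [hphi.inner_feature_feature hk i.2 j.2, Subtype.ext_iff]

/-- **Mercer's theorem** on the diagonal. -/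
theorem IsEigenSystem.hasSum_inner_feature_sq [HereditarilyLindelofSpace S]
    (hphi : IsEigenSystem K P lam phi)
    (hk : ∀ x y, K x y = inner ℝ (k x) (k y)) (hinj : KernelOpInjective K P) {x : S}
    (hx : x ∈ P.support) :
    HasSum (fun j => inner ℝ (hphi.feature k j) (k x) ^ 2) (K x x) := by
  have h1 := hasSum_inner_sq_of_orthonormal (hphi.orthonormal_feature hk) (x := k x) (by
    intro h hh
    -- A vector orthogonal to all features has an image orthogonal to all eigenfunctions, which is
    -- zero by completeness. Thus `⟪h, k s⟫` vanishes almost everywhere and, by continuity, on the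
    -- support.
    have h0 : featureEvalL2 k P h = 0 := by
      refine hphi.eq_zero_of_orthogonal hk hinj fun j hj => ?_
      have h2 := hh ⟨j, hj⟩
      rw [IsEigenSystem.feature, inner_smul_left, ContinuousLinearMap.adjoint_inner_left] at h2
      refine (mul_eq_zero.mp h2).resolve_left ?_
      simpa using (Real.sqrt_pos.mpr hj).ne'
    have h3 : ∀ᵐ s ∂P, inner ℝ h (k s) = 0 := by
      filter_upwards [coeFn_featureEvalL2 k P h, Lp.coeFn_zero ℝ 2 P] with s hs1 hs2
      rw [← hs1, h0, hs2]
      rfl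
    by_contra hne
    have hopen : IsOpen {s : S | inner ℝ h (k s) ≠ 0} :=
      isOpen_ne_fun (by fun_prop) continuous_const
    have hpos := (Measure.mem_support_iff_forall x).mp hx _ (hopen.mem_nhds hne)
    exact hpos.ne' (ae_iff.mp h3))
  rw [hk, real_inner_self_eq_norm_sq]
  refine (hasSum_subtype_iff_of_support_subset
    (f := fun j => inner ℝ (hphi.feature k j) (k x) ^ 2) (s := {j | 0 < lam j}) ?_).mp h1
  intro j hj
  by_contra hj'
  exact hj (by simp [hphi.feature_eq_zero hj'])

end Mercer

/-! ### The feature map of a Mercer kernel -/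

section FeatureMap

open Filter Topology

universe u

variable {S : Type u} [TopologicalSpace S] {K : S → S → ℝ}

theorem IsMercerKernel.symm (hK : IsMercerKernel K) (x y : S) : K x y = K y x := by
  have := (hK.posSemidef 2 ![x, y]).isHermitian.apply 0 1
  simpa using this.symm

theorem IsMercerKernel.sum_nonneg (hK : IsMercerKernel K) (s : Finset S) (c : S → ℝ) :
    0 ≤ ∑ x ∈ s, ∑ y ∈ s, c x * c y * K x y := by
  have h := (hK.posSemidef s.card fun i => (s.equivFin.symm i : S)).dotProduct_mulVec_nonneg
    fun i => c (s.equivFin.symm i)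
  have h1 : ∀ f : S → ℝ, ∑ i, f (s.equivFin.symm i) = ∑ x ∈ s, f x := by
    intro f
    rw [Equiv.sum_comp s.equivFin.symm (fun x : s => f x), Finset.sum_coe_sort]
  refine h.trans_eq ?_
  rw [← h1 fun x => ∑ y ∈ s, c x * c y * K x y]
  simp only [dotProduct, Matrix.mulVec, Matrix.of_apply, Pi.star_apply, star_trivial,
    Finset.mul_sum]
  refine Finset.sum_congr rfl fun i _ => ?_
  rw [← h1 fun y => c (s.equivFin.symm i) * c y * K (s.equivFin.symm i) y]
  exact Finset.sum_congr rfl fun j _ => by ring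

/-- A Mercer kernel is the kernel of a continuous map into a Hilbert space. -/
theorem IsMercerKernel.exists_feature (hK : IsMercerKernel K) :
    ∃ (H : Type u) (_ : NormedAddCommGroup H) (_ : InnerProductSpace ℝ H) (_ : CompleteSpace H)
      (k : C(S, H)), ∀ x y, K x y = inner ℝ (k x) (k y) := by
  -- The RKHS construction takes operator-valued kernels; scalars act as multiples of the identity
  -- of `ℝ`.
  let L : Matrix S S (ℝ →L[ℝ] ℝ) := Matrix.of fun x y => K x y • ContinuousLinearMap.id ℝ ℝ
  have hL : L.PosSemidef := by
    have h := (RKHS.posSemidef_tfae (K := L)).out 0 2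
    refine h.mpr ⟨?_, ?_⟩
    · ext x y
      simp [L, hK.symm x y, ContinuousLinearMap.star_eq_adjoint, ContinuousLinearMap.adjoint_id]
    · intro v
      refine (hK.sum_nonneg v.support v).trans_eq ?_
      simp only [Finsupp.sum, L, Matrix.of_apply, RCLike.re_to_real]
      refine Finset.sum_congr rfl fun x _ => Finset.sum_congr rfl fun y _ => ?_
      rw [hK.symm x y]
      simp
      ring
  have : Fact L.PosSemidef := ⟨hL⟩
  let k : S → RKHS.OfKernel L := fun x => RKHS.kerFun (RKHS.OfKernel L) x 1
  have hk : ∀ x y, K x y = inner ℝ (k x) (k y) := by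
    intro x y
    have := RKHS.kernel_inner (RKHS.OfKernel L) y x (1 : ℝ) 1
    rw [RKHS.OfKernel.kernel_ofKernel] at this
    rw [← this, hK.symm]
    simp [L]
  refine ⟨RKHS.OfKernel L, inferInstance, inferInstance, inferInstance, ⟨k, ?_⟩, hk⟩
  rw [continuous_iff_continuousAt]
  intro x
  rw [ContinuousAt, tendsto_iff_norm_sub_tendsto_zero]
  -- The radicand is `‖k y - k x‖²`.
  have hc : Continuous fun y => √(K y y - 2 * K y x + K x x) := by
    have h1 : Continuous fun y => K y y := 
      hK.continuous.comp (by fun_prop : Continuous fun y => (y, y))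
    have h2 : Continuous fun y => K y x := 
      hK.continuous.comp (by fun_prop : Continuous fun y => (y, x))
    exact ((h1.sub (h2.const_mul 2)).add continuous_const).sqrt
  have h0 := hc.tendsto x
  have h1 : K x x - 2 * K x x + K x x = 0 := by ring
  rw [h1, Real.sqrt_zero] at h0
  refine h0.congr fun y => ?_
  rw [hk, hk, hk, real_inner_self_eq_norm_sq, real_inner_self_eq_norm_sq, ← norm_sub_sq_real,
    Real.sqrt_sq (norm_nonneg _)]

end FeatureMap

/-! ### Tail eigenvalues of Gram matrices -/

section Gram

open Module

variable {H : Type*} [NormedAddCommGroup H] [InnerProductSpace ℝ H] {n : ℕ}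

theorem isPositive_toEuclideanLin_smul_gram {c : ℝ} (hc : 0 ≤ c) (a : Fin n → H) :
    (Matrix.toEuclideanLin (c • Matrix.gram ℝ a)).IsPositive :=
  Matrix.isPositive_toEuclideanLin_iff.mpr ((Matrix.posSemidef_gram ℝ a).smul hc)

theorem inner_toEuclideanLin_smul_gram (c : ℝ) (a : Fin n → H) (x : EuclideanSpace ℝ (Fin n)) :
    inner ℝ x (Matrix.toEuclideanLin (c • Matrix.gram ℝ a) x) = c * ‖∑ i, x i • a i‖ ^ 2 := by
  rw [← real_inner_self_eq_norm_sq, ← Matrix.star_dotProduct_gram_mulVec, map_smul,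
    LinearMap.smul_apply, inner_smul_right, EuclideanSpace.inner_eq_star_dotProduct,
    dotProduct_comm]
  rfl

theorem trace_toEuclideanLin_smul_gram (c : ℝ) (a : Fin n → H) :
    LinearMap.trace ℝ _ (Matrix.toEuclideanLin (c • Matrix.gram ℝ a)) = c * ∑ i, ‖a i‖ ^ 2 := by
  rw [Matrix.toEuclideanLin, Matrix.toLpLin_eq_toLin, Matrix.trace_toLin_eq, Matrix.trace_smul]
  simp [Matrix.trace]

/-- Subtracting from each vector a combination of `m` fixed vectors bounds the singular values of
the Gram matrix from the `m`-th on. -/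
theorem sum_singularValues_gram_le {c : ℝ} (hc : 0 ≤ c) (a : Fin n → H) (e : ℕ → H) (m : ℕ) :
    ∑ j ∈ Finset.Ico m n, (Matrix.toEuclideanLin (c • Matrix.gram ℝ a)).singularValues j ≤
      c * ∑ i, ‖a i - ∑ l ∈ Finset.range m, (inner ℝ (e l) (a i) : ℝ) • e l‖ ^ 2 := by
  rw [← trace_toEuclideanLin_smul_gram]
  let G : EuclideanSpace ℝ (Fin n) →ₗ[ℝ] (Fin m → ℝ) :=
    { toFun := fun x l => inner ℝ (e l) (∑ i, x i • a i)
      map_add' := fun x y => by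
        ext l; simp [add_smul, Finset.sum_add_distrib, inner_add_right]
      map_smul' := fun r x => by
        ext l; simp [mul_smul, ← Finset.smul_sum, inner_smul_right] }
  refine (isPositive_toEuclideanLin_smul_gram hc a).sum_singularValues_Ico_le_trace
    (isPositive_toEuclideanLin_smul_gram hc _) finrank_euclideanSpace_fin (LinearMap.ker G) ?_ ?_
  · have h1 := G.finrank_range_add_finrank_ker
    have h2 := Submodule.finrank_le (LinearMap.range G)
    rw [finrank_euclideanSpace_fin] at h1
    rw [finrank_fin_fun] at h2
    omega
  · intro x hx
    rw [inner_toEuclideanLin_smul_gram, inner_toEuclideanLin_smul_gram]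
    -- On `ker G`, of codimension at most `m`, the subtracted combinations cancel, so the two
    -- quadratic forms agree.
    have h1 : ∀ l ∈ Finset.range m, (inner ℝ (e l) (∑ i, x i • a i) : ℝ) = 0 := fun l hl =>
      congrFun (LinearMap.mem_ker.mp hx) ⟨l, Finset.mem_range.mp hl⟩
    have h2 : ∑ i, x i • ∑ l ∈ Finset.range m, (inner ℝ (e l) (a i) : ℝ) • e l = 0 := by
      simp_rw [Finset.smul_sum, smul_smul]
      rw [Finset.sum_comm]
      refine Finset.sum_eq_zero fun l hl => ?_
      have := h1 l hl
      simp_rw [inner_sum, inner_smul_right] at this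
      rw [← Finset.sum_smul, this, zero_smul]
    simp_rw [smul_sub, Finset.sum_sub_distrib]
    rw [h2, sub_zero]

/-- Pythagoras; zero vectors are admitted because features of zero eigenvalue vanish. -/
theorem norm_sub_sum_inner_smul_sq {ι : Type*} [DecidableEq ι] {e : ι → H}
    (horth : ∀ i j, i ≠ j → inner ℝ (e i) (e j) = 0) (hnorm : ∀ i, ‖e i‖ = 1 ∨ e i = 0)
    (s : Finset ι) (x : H) : ‖x - ∑ l ∈ s, (inner ℝ (e l) x : ℝ) • e l‖ ^ 2 =
      ‖x‖ ^ 2 - ∑ l ∈ s, (inner ℝ (e l) x : ℝ) ^ 2 := by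
  have h1 : inner ℝ x (∑ l ∈ s, (inner ℝ (e l) x : ℝ) • e l) =
      ∑ l ∈ s, (inner ℝ (e l) x : ℝ) ^ 2 := by
    rw [inner_sum]
    refine Finset.sum_congr rfl fun l _ => ?_
    rw [inner_smul_right, real_inner_comm, sq]
  have h2 : ‖∑ l ∈ s, (inner ℝ (e l) x : ℝ) • e l‖ ^ 2 = ∑ l ∈ s, (inner ℝ (e l) x : ℝ) ^ 2 := by
    rw [← real_inner_self_eq_norm_sq, inner_sum]
    refine Finset.sum_congr rfl fun l hl => ?_
    rw [sum_inner, Finset.sum_eq_single_of_mem l hl]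
    · rw [inner_smul_left, inner_smul_right, real_inner_self_eq_norm_sq]
      rcases hnorm l with h | h <;> simp [h, sq]
    · intro i _ hi
      rw [inner_smul_left, inner_smul_right, horth i l hi]
      simp
  rw [norm_sub_sq_real, h1, h2]
  ring

end Gram

/-! ### Singular values of matrices and submatrices -/

section SingVal

open Filter Topology

theorem continuous_singVal {n N : ℕ} (j : ℕ) :
    Continuous fun A : Matrix (Fin n) (Fin N) ℝ => singVal A j := by
  let G : Matrix (Fin n) (Fin N) ℝ →ₗ[ℝ]
      EuclideanSpace ℝ (Fin N) →L[ℝ] EuclideanSpace ℝ (Fin n) :=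
    LinearMap.toContinuousLinearMap.toLinearMap ∘ₗ Matrix.toEuclideanLin.toLinearMap
  have hG : Continuous G := G.continuous_of_finiteDimensional
  have h : ∀ A A', singVal A j ≤ singVal A' j + ‖G (A - A')‖ := by
    intro A A'
    refine LinearMap.singularValues_le_add _ _ (norm_nonneg _) (fun x => ?_) j
    rw [← LinearMap.sub_apply, ← map_sub]
    exact (G (A - A')).le_opNorm x
  rw [continuous_iff_continuousAt]
  intro A
  rw [ContinuousAt, tendsto_iff_norm_sub_tendsto_zero]
  have h0 : Tendsto (fun B => ‖G (B - A)‖) (𝓝 A) (𝓝 0) := by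
    have : Continuous fun B => ‖G (B - A)‖ := by fun_prop
    simpa using this.tendsto A
  refine squeeze_zero (fun _ => norm_nonneg _) (fun B => ?_) h0
  have h1 := h B A
  have h2 := h A B
  rw [← neg_sub, map_neg, norm_neg] at h2
  rw [Real.norm_eq_abs, abs_le]
  constructor <;> linarith

theorem singVal_nonneg {n N : ℕ} (A : Matrix (Fin n) (Fin N) ℝ) (j : ℕ) : 0 ≤ singVal A j :=
  LinearMap.singularValues_nonneg _ j

/-- Selecting distinct columns is composing with an isometric embedding of coordinate spaces. -/
theorem singVal_submatrix_le {n N M : ℕ} (A : Matrix (Fin n) (Fin M) ℝ) {f : Fin N → Fin M}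
    (hf : Function.Injective f) (j : ℕ) : singVal (A.submatrix id f) j ≤ singVal A j := by
  let b := EuclideanSpace.basisFun (Fin N) ℝ
  let b' := EuclideanSpace.basisFun (Fin M) ℝ
  let J₀ : EuclideanSpace ℝ (Fin N) →ₗ[ℝ] EuclideanSpace ℝ (Fin M) :=
    b.toBasis.constr ℝ fun i => b' (f i)
  have hJ₀ : ⇑J₀ ∘ ⇑b.toBasis = b' ∘ f := by
    ext1 i
    simp only [Function.comp_apply, J₀, Module.Basis.constr_basis]
  let J := J₀.isometryOfOrthonormal (v := b.toBasis) (by simp)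
    (by rw [hJ₀]; exact b'.orthonormal.comp f hf)
  have : Matrix.toEuclideanLin (A.submatrix id f) = Matrix.toEuclideanLin A ∘ₗ J.toLinearMap := by
    refine b.toBasis.ext fun i => ?_
    have h1 : J (b.toBasis i) = b' (f i) := by
      change J₀ (b.toBasis i) = _
      exact congrFun hJ₀ i
    rw [LinearMap.comp_apply, LinearIsometry.coe_toLinearMap, h1]
    ext l
    simp [b, b', Matrix.toLpLin_apply]
  rw [singVal, this]
  exact LinearMap.singularValues_comp_linearIsometry_le _ J j

end SingVal

/-! ### Bounds for a fixed sample, and the mean residual -/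

section Bounds

variable {S : Type*} [TopologicalSpace S] [CompactSpace S] [MeasurableSpace S] [BorelSpace S]
  {H : Type*} [NormedAddCommGroup H] [InnerProductSpace ℝ H] [CompleteSpace H]
  {K : S → S → ℝ} {k : C(S, H)} {P ρ : Measure S} [IsFiniteMeasure P] [IsFiniteMeasure ρ]
  {lam : ℕ → ℝ} {phi : ℕ → S → ℝ}

theorem Continuous.integrable_of_compactSpace {f : S → ℝ} (hf : Continuous f) :
    Integrable f ρ :=
  hf.integrable_of_hasCompactSupport (HasCompactSupport.of_compactSpace f)

omit [IsFiniteMeasure ρ] in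
theorem IsEigenSystem.integral_inner_feature_sq (hphi : IsEigenSystem K P lam phi)
    (hk : ∀ x y, K x y = inner ℝ (k x) (k y)) (hρ : ρ ≪ P) (j : ℕ) :
    ∫ x, inner ℝ (hphi.feature k j) (k x) ^ 2 ∂ρ = lam j * sqNorm ρ (phi j) := by
  rcases lt_or_ge 0 (lam j) with hj | hj
  · rw [sqNorm, ← integral_const_mul]
    refine integral_congr_ae ?_
    filter_upwards [hρ.ae_le (hphi.eigen j)] with x hx
    rw [hphi.inner_feature_apply hk, hx, mul_pow, inv_pow, Real.sq_sqrt hj.le, sq_abs]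
    field_simp
  · rw [hphi.feature_eq_zero hj.not_gt, le_antisymm hj (hphi.nonneg j)]
    simp

/-- The residual of the kernel on the diagonal after removing the first `m` eigenfunctions. -/
noncomputable def IsEigenSystem.residual (hphi : IsEigenSystem K P lam phi) (k : C(S, H)) (m : ℕ)
    (x : S) : ℝ :=
  ‖k x - ∑ l ∈ Finset.range m, (inner ℝ (hphi.feature k l) (k x) : ℝ) • hphi.feature k l‖ ^ 2

theorem IsEigenSystem.continuous_residual (hphi : IsEigenSystem K P lam phi) (m : ℕ) :
    Continuous (hphi.residual k m) := by
  unfold IsEigenSystem.residual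
  fun_prop

theorem IsEigenSystem.residual_eq (hphi : IsEigenSystem K P lam phi)
    (hk : ∀ x y, K x y = inner ℝ (k x) (k y)) (m : ℕ) (x : S) :
    hphi.residual k m x =
      K x x - ∑ l ∈ Finset.range m, (inner ℝ (hphi.feature k l) (k x) : ℝ) ^ 2 := by
  rw [IsEigenSystem.residual, hk, real_inner_self_eq_norm_sq]
  refine norm_sub_sum_inner_smul_sq (fun i j hij => ?_) (fun i => ?_) _ _
  · by_cases hi : 0 < lam i
    · by_cases hj : 0 < lam j
      · rw [hphi.inner_feature_feature hk hi hj, if_neg hij]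
      · rw [hphi.feature_eq_zero hj, inner_zero_right]
    · rw [hphi.feature_eq_zero hi, inner_zero_left]
  · by_cases hi : 0 < lam i
    · exact Or.inl ((hphi.orthonormal_feature hk).1 ⟨i, hi⟩)
    · exact Or.inr (hphi.feature_eq_zero hi)

/-- The residual is the tail of the Mercer series on the support of `P`, which carries `ρ`. In `[0,
∞]` the sum and the integral commute without a summability condition. -/
theorem IsEigenSystem.ofReal_integral_residual [HereditarilyLindelofSpace S]
    (hphi : IsEigenSystem K P lam phi) (hk : ∀ x y, K x y = inner ℝ (k x) (k y))
    (hinj : KernelOpInjective K P) (hρ : ρ ≪ P) (m : ℕ) :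
    ENNReal.ofReal (∫ x, hphi.residual k m x ∂ρ) =
      ∑' i, ENNReal.ofReal (lam (m + i) * sqNorm ρ (phi (m + i))) := by
  have hcont : ∀ j, Continuous fun x => (inner ℝ (hphi.feature k j) (k x) : ℝ) ^ 2 := fun j => by
    fun_prop
  rw [ofReal_integral_eq_lintegral_ofReal (hphi.continuous_residual m).integrable_of_compactSpace
    (Filter.Eventually.of_forall fun x => sq_nonneg _)]
  calc ∫⁻ x, ENNReal.ofReal (hphi.residual k m x) ∂ρ
      = ∫⁻ x, ∑' i, ENNReal.ofReal (inner ℝ (hphi.feature k (m + i)) (k x) ^ 2) ∂ρ := by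
        refine lintegral_congr_ae ?_
        filter_upwards [hρ.ae_le (Measure.support_mem_ae (μ := P))] with x hx
        have h := hphi.hasSum_inner_feature_sq hk hinj hx
        have h1 : HasSum (fun i => (inner ℝ (hphi.feature k (m + i)) (k x) : ℝ) ^ 2)
            (hphi.residual k m x) := by
          rw [hphi.residual_eq hk]
          simpa only [add_comm m] using (hasSum_nat_add_iff' m).mpr h
        rw [← h1.tsum_eq, ENNReal.ofReal_tsum_of_nonneg (fun _ => sq_nonneg _) h1.summable]
    _ = ∑' i, ∫⁻ x, ENNReal.ofReal (inner ℝ (hphi.feature k (m + i)) (k x) ^ 2) ∂ρ :=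
        lintegral_tsum fun i => (hcont (m + i)).measurable.ennreal_ofReal.aemeasurable
    _ = _ := by
        refine tsum_congr fun i => ?_
        rw [← ofReal_integral_eq_lintegral_ofReal (hcont (m + i)).integrable_of_compactSpace
          (Filter.Eventually.of_forall fun x => sq_nonneg _),
          hphi.integral_inner_feature_sq hk hρ]

omit [TopologicalSpace S] [CompactSpace S] [BorelSpace S] [IsFiniteMeasure ρ] in
theorem tsum_ofReal_le_tailRatio_mul (hlam : ∀ j, 0 ≤ lam j) {m : ℕ}
    (hsum : tailRatio ρ lam phi m < ∞) :
    ∑' i, ENNReal.ofReal (lam (m + i) * sqNorm ρ (phi (m + i))) ≤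
      tailRatio ρ lam phi m * ENNReal.ofReal (lam m * sqNorm ρ (phi m)) := by
  have hsq : ∀ j, 0 ≤ sqNorm ρ (phi j) := fun j => integral_nonneg fun x => by positivity
  rw [tailRatio, ← ENNReal.tsum_mul_right]
  refine ENNReal.tsum_le_tsum fun i => ?_
  have hfin := ENNReal.ne_top_of_tsum_ne_top hsum.ne i
  have h1 : ENNReal.ofReal (lam (m + i) * sqNorm ρ (phi (m + i))) ≤
      ENNReal.ofReal (((i : ℝ) + 1) * lam (m + i) * sqNorm ρ (phi (m + i))) := by
    refine ENNReal.ofReal_le_ofReal ?_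
    have := mul_nonneg (hlam (m + i)) (hsq (m + i))
    have hi : (0 : ℝ) ≤ i := i.cast_nonneg
    nlinarith
  refine h1.trans ?_
  rcases eq_or_ne (ENNReal.ofReal (lam m * sqNorm ρ (phi m))) 0 with h0 | h0
  -- With a zero denominator, finiteness of the ratio forces every numerator to vanish.
  · rw [h0] at hfin ⊢
    by_contra hne
    refine hfin (ENNReal.div_zero fun h => hne ?_)
    rw [h]
    exact zero_le
  · rw [ENNReal.div_mul_cancel h0 ENNReal.ofReal_ne_top]

omit [CompactSpace S] [MeasurableSpace S] [BorelSpace S] [CompleteSpace H] in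
theorem gramMatrix_eq_smul_gram (hk : ∀ x y, K x y = inner ℝ (k x) (k y)) {n : ℕ}
    (x : Fin n → S) :
    gramMatrix K x = (1 / (n : ℝ)) • Matrix.gram ℝ fun i => k (x i) := by
  ext i j
  simp [gramMatrix, hk]

omit [TopologicalSpace S] [CompactSpace S] [MeasurableSpace S] [BorelSpace S] in
theorem singVal_truncGramMatrix_le {n N : ℕ} (hN : N ≤ n) (x : Fin n → S) (j : ℕ) :
    singVal (truncGramMatrix K hN x) j ≤ singVal (gramMatrix K x) j :=
  singVal_submatrix_le _ (Fin.castLE_injective hN) j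

theorem IsEigenSystem.sum_singVal_truncGramMatrix_le (hphi : IsEigenSystem K P lam phi)
    (hk : ∀ x y, K x y = inner ℝ (k x) (k y)) {n N : ℕ} (hN : N ≤ n) (x : Fin n → S) (m : ℕ) :
    ∑ j ∈ Finset.Ico m N, singVal (truncGramMatrix K hN x) j ≤
      1 / (n : ℝ) * ∑ i, hphi.residual k m (x i) := by
  calc _ ≤ ∑ j ∈ Finset.Ico m N, singVal (gramMatrix K x) j :=
        Finset.sum_le_sum fun j _ => singVal_truncGramMatrix_le hN x j
    _ ≤ ∑ j ∈ Finset.Ico m n, singVal (gramMatrix K x) j :=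
        Finset.sum_le_sum_of_subset_of_nonneg (Finset.Ico_subset_Ico_right hN)
          fun j _ _ => singVal_nonneg _ j
    _ ≤ _ := by
        rw [gramMatrix_eq_smul_gram hk]
        exact sum_singularValues_gram_le (by positivity) _ (hphi.feature k) m

omit [CompactSpace S] [MeasurableSpace S] [BorelSpace S] [CompleteSpace H] in
-- The trace of the Gram matrix is the mean of `K (x i) (x i)`, hence at most `κ`.
theorem singVal_truncGramMatrix_le_div (hk : ∀ x y, K x y = inner ℝ (k x) (k y)) {n N : ℕ}
    (hN : N ≤ n) (x : Fin n → S) {m j : ℕ} (hm : m < n) (hj : m ≤ j) {κ : ℝ}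
    (hκ : ∀ y, K y y ≤ κ) : singVal (truncGramMatrix K hN x) j ≤ κ / ((m : ℝ) + 1) := by
  have hn : (0 : ℝ) < n := by exact_mod_cast (Nat.zero_le m).trans_lt hm
  have h1 := (isPositive_toEuclideanLin_smul_gram (c := 1 / (n : ℝ)) (by positivity)
    fun i => k (x i)).add_one_mul_singularValues_le_trace finrank_euclideanSpace_fin hm
  rw [trace_toEuclideanLin_smul_gram] at h1
  have h2 : ∑ i, ‖k (x i)‖ ^ 2 ≤ n * κ := by
    calc ∑ i, ‖k (x i)‖ ^ 2 ≤ ∑ _i : Fin n, κ := Finset.sum_le_sum fun i _ => by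
          rw [← real_inner_self_eq_norm_sq, ← hk]
          exact hκ _
      _ = n * κ := by simp
  have h3 : 1 / (n : ℝ) * ∑ i, ‖k (x i)‖ ^ 2 ≤ κ := by
    rw [one_div, inv_mul_le_iff₀ hn]
    exact h2
  have h4 : singVal (gramMatrix K x) m ≤ κ / ((m : ℝ) + 1) := by
    rw [gramMatrix_eq_smul_gram hk, le_div_iff₀ (by positivity), mul_comm]
    exact h1.trans h3
  exact (singVal_truncGramMatrix_le hN x j).trans
    ((LinearMap.singularValues_antitone _ hj).trans h4)

omit [CompactSpace S] [MeasurableSpace S] [BorelSpace S] in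
theorem continuous_singVal_truncGramMatrix (hK : Continuous (Function.uncurry K)) {n N : ℕ}
    (hN : N ≤ n) (j : ℕ) : Continuous fun x : Fin n → S => singVal (truncGramMatrix K hN x) j := by
  refine (continuous_singVal j).comp ?_
  refine continuous_matrix fun i l => ?_
  refine continuous_const.mul ?_
  exact hK.comp (by fun_prop : Continuous fun x : Fin n → S => (x i, x (Fin.castLE hN l)))

end Bounds

/-! ### Expectation over the random sample -/

theorem corollary1 {d : ℕ} (X : Set (EuclideanSpace ℝ (Fin d))) (hX : IsCompact X)
    (K : X → X → ℝ) (hK : IsMercerKernel K)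
    (P ρ : Measure X) [IsProbabilityMeasure P] [IsProbabilityMeasure ρ]
    (hinj : KernelOpInjective K P) (hρ : HasBoundedDensity ρ P)
    (lam : ℕ → ℝ) (phi : ℕ → X → ℝ) (hphi : IsEigenSystem K P lam phi)
    {Ω : Type*} [MeasurableSpace Ω] (μ : Measure Ω) [IsProbabilityMeasure μ]
    (n N : ℕ) (hN : N ≤ n) (Z : Fin n → Ω → X)
    (hlaw : ∀ i, HasLaw (Z i) ρ μ) (hindep : iIndepFun Z μ)
    (m : ℕ) (hm : m < N) (hsum : tailRatio ρ lam phi m < ∞) :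
    (Integrable (fun ω => ∑ j ∈ Finset.Ico m N,
        singVal (truncGramMatrix K hN (fun i => Z i ω)) j) μ ∧
      ∫ ω, ∑ j ∈ Finset.Ico m N, singVal (truncGramMatrix K hN (fun i => Z i ω)) j ∂μ
        ≤ (tailRatio ρ lam phi m).toReal * (lam m * sqNorm ρ (phi m))) ∧
    (Integrable (fun ω => ∑ j ∈ Finset.Ico m N,
        singVal (truncGramMatrix K hN (fun i => Z i ω)) j ^ 2) μ ∧
      ∫ ω, ∑ j ∈ Finset.Ico m N, singVal (truncGramMatrix K hN (fun i => Z i ω)) j ^ 2 ∂μ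
        ≤ (tailRatio ρ lam phi m).toReal *
          ((⨆ x : X, K x x) / ((m : ℝ) + 1) * (lam m * sqNorm ρ (phi m)))) := by
  have : CompactSpace X := isCompact_iff_compactSpace.mp hX
  obtain ⟨H, _, _, _, k, hk⟩ := hK.exists_feature
  have hn : 0 < n := by omega
  have hn' : (n : ℝ) ≠ 0 := by exact_mod_cast hn.ne'
  have hZ : AEMeasurable (fun ω i => Z i ω) μ := aemeasurable_pi_lambda _ fun i =>
    (hlaw i).aemeasurable
  -- Continuous functions of the sample are bounded, the space of samples being compact.
  have hint : ∀ f : (Fin n → X) → ℝ, Continuous f → Integrable (fun ω => f fun i => Z i ω) μ := by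
    intro f hf
    obtain ⟨C, hC⟩ := isCompact_univ.exists_bound_of_continuousOn hf.continuousOn
    exact Integrable.of_bound (hf.measurable.comp_aemeasurable hZ).aestronglyMeasurable C
      (Filter.Eventually.of_forall fun ω => hC _ (Set.mem_univ _))
  have hσ := fun j => continuous_singVal_truncGramMatrix hK.continuous hN j
  have hint1 := hint (fun x => ∑ j ∈ Finset.Ico m N, singVal (truncGramMatrix K hN x) j)
    (continuous_finsetSum _ fun j _ => hσ j)
  have hint2 := hint (fun x => ∑ j ∈ Finset.Ico m N, singVal (truncGramMatrix K hN x) j ^ 2)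
    (continuous_finsetSum _ fun j _ => (hσ j).pow 2)
  have hr := hphi.continuous_residual (k := k) m
  have hres : ∫ ω, 1 / (n : ℝ) * ∑ i, hphi.residual k m (Z i ω) ∂μ =
      ∫ x, hphi.residual k m x ∂ρ := by
    rw [integral_const_mul, integral_finsetSum _ fun i _ =>
      hint (fun x => hphi.residual k m (x i)) (hr.comp (continuous_apply i))]
    have : ∀ i, ∫ ω, hphi.residual k m (Z i ω) ∂μ = ∫ x, hphi.residual k m x ∂ρ := fun i =>
      (hlaw i).integral_comp hr.measurable.aestronglyMeasurable
    simp [this, hn']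
  have hb : 0 ≤ lam m * sqNorm ρ (phi m) :=
    mul_nonneg (hphi.nonneg m) (integral_nonneg fun x => by positivity)
  have hbound1 : ∫ ω, ∑ j ∈ Finset.Ico m N, singVal (truncGramMatrix K hN (fun i => Z i ω)) j ∂μ
      ≤ (tailRatio ρ lam phi m).toReal * (lam m * sqNorm ρ (phi m)) := by
    calc _ ≤ ∫ ω, 1 / (n : ℝ) * ∑ i, hphi.residual k m (Z i ω) ∂μ :=
          integral_mono hint1 (hint (fun x => 1 / (n : ℝ) * ∑ i, hphi.residual k m (x i))
            (continuous_const.mul (continuous_finsetSum _ fun i _ =>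
              hr.comp (continuous_apply i))))
            fun ω => hphi.sum_singVal_truncGramMatrix_le hk hN _ m
      _ = ∫ x, hphi.residual k m x ∂ρ := hres
      _ ≤ (tailRatio ρ lam phi m * ENNReal.ofReal (lam m * sqNorm ρ (phi m))).toReal := by
          rw [← ENNReal.ofReal_le_iff_le_toReal (ENNReal.mul_ne_top hsum.ne ENNReal.ofReal_ne_top),
            hphi.ofReal_integral_residual hk hinj hρ.1]
          exact tsum_ofReal_le_tailRatio_mul hphi.nonneg hsum
      _ = _ := by rw [ENNReal.toReal_mul, ENNReal.toReal_ofReal hb]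
  refine ⟨⟨hint1, hbound1⟩, hint2, ?_⟩
  have hdiag : Continuous fun x => K x x :=
    hK.continuous.comp (by fun_prop : Continuous fun x : X => (x, x))
  have hκ : ∀ y, K y y ≤ ⨆ x : X, K x x := le_ciSup (isCompact_range hdiag).bddAbove
  have hκ0 : 0 ≤ ⨆ x : X, K x x := Real.iSup_nonneg fun x => by
    rw [hk]; exact real_inner_self_nonneg
  -- One factor of each square is bounded uniformly, the other by the first estimate.
  calc _ ≤ ∫ ω, (⨆ x : X, K x x) / ((m : ℝ) + 1) *
        ∑ j ∈ Finset.Ico m N, singVal (truncGramMatrix K hN (fun i => Z i ω)) j ∂μ := by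
        refine integral_mono hint2 (hint1.const_mul _) fun ω => ?_
        simp only [Finset.mul_sum]
        refine Finset.sum_le_sum fun j hj => ?_
        rw [sq]
        exact mul_le_mul_of_nonneg_right (singVal_truncGramMatrix_le_div hk hN _
          (hm.trans_le hN) (Finset.mem_Ico.mp hj).1 hκ) (singVal_nonneg _ j)
    _ ≤ (⨆ x : X, K x x) / ((m : ℝ) + 1) *
        ((tailRatio ρ lam phi m).toReal * (lam m * sqNorm ρ (phi m))) := by
        rw [integral_const_mul]
        exact mul_le_mul_of_nonneg_left hbound1 (by positivity)
    _ = _ := by ring
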